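/- Write $\mathbb D=\{z\in\mathbb C:|z|<1\}$. For analytic functions $F,G$ on $\mathbb D$, $F\prec G$ (subordination) means that there is an analytic $w:\mathbb D\to\mathbb D$ with $w(0)=0$ and $F=G\circ w$ on $\mathbb D$; a quotient on the left of $\prec$ is understood to be analytic on $\mathbb D$ after its removable singularities are removed. Let $\mathcal A$ be the class of analytic functions $f$ on $\mathbb D$ with $f(0)=0$, $f'(0)=1$. Let $\psi$ be a Ma--Minda function, i.e. $\psi$ is analytic and univalent on $\mathbb D$, $\operatorname{Re}\psi>0$ on $\mathbb D$, $\psi(0)=1$, $\psi'(0)>0$, and $\psi(\mathbb D)$ is symmetric about the real axis; let $\mathcal S^*(\psi)=\{f\in\mathcal A: zf'(z)/f(z)\prec\psi(z)\}$. **Theorem.** Let $h$ be analytic on $\mathbb D$ with $h(0)=0$ and $h'(0)\neq0$. Suppose that $$\operatorname{Re}\left(1+\frac{zh''(z)}{h'(z)}\right)>-\frac12\quad(z\in\mathbb D)\qquad\text{and}\qquad \frac1z\int_0^z h(t)\,dt\prec\frac{\psi(z)-1}{\psi(z)}.$$ If $f\in\mathcal A$ and $$\frac{f(z)f''(z)}{(f'(z))^2}\prec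 h(z),$$ then $f\in\mathcal S^*(\psi)$. -/

import Mathlib

open Set Metric

/-- `f` is analytic in the open unit disk and normalised by `f 0 = 0`, `f' 0 = 1`, i.e.
`f(z) = z + a₂ z² + a₃ z³ + ⋯` there (the class `𝒜`). -/
def IsNormalizedAnalytic (f : ℂ → ℂ) : Prop :=
  AnalyticOnNhd ℂ f (ball 0 1) ∧ f 0 = 0 ∧ deriv f 0 = 1

/-- A Schwarz function: an analytic self-map of the open unit disk that fixes the origin. -/
def IsSchwarzFunction (w : ℂ → ℂ) : Prop :=
  AnalyticOnNhd ℂ w (ball 0 1) ∧ MapsTo w (ball 0 1) (ball 0 1) ∧ w 0 = 0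

/-- Subordination `F ≺ G` of analytic functions in the open unit disk. -/
def Subordinate (F G : ℂ → ℂ) : Prop :=
  ∃ w : ℂ → ℂ, IsSchwarzFunction w ∧ ∀ z ∈ ball (0 : ℂ) 1, F z = G (w z)

/-- Subordination `N / M ≺ G` of a quotient of analytic functions (`M` not identically zero) that
is analytic in the open unit disk once its removable singularities have been removed:
`F` is the analytic function that the quotient represents. -/
def QuotientSubordinate (N M G : ℂ → ℂ) : Prop :=
  ∃ F : ℂ → ℂ, AnalyticOnNhd ℂ F (ball 0 1) ∧
    (∀ z ∈ ball (0 : ℂ) 1, M z ≠ 0 → F z = N z / M z) ∧ Subordinate F G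

/-- A Ma–Minda function: analytic and univalent in the open unit disk, with positive real part,
`ψ 0 = 1`, `ψ' 0 > 0`, and image of the disk symmetric about the real axis. -/
structure IsMaMinda (ψ : ℂ → ℂ) : Prop where
  analytic : AnalyticOnNhd ℂ ψ (ball 0 1)
  univalent : InjOn ψ (ball 0 1)
  re_pos : ∀ z ∈ ball (0 : ℂ) 1, 0 < (ψ z).re
  map_zero : ψ 0 = 1
  deriv_zero_pos : 0 < (deriv ψ 0).re ∧ (deriv ψ 0).im = 0
  symmetric : ∀ u ∈ ψ '' ball 0 1, (starRingEnd ℂ) u ∈ ψ '' ball 0 1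

/-- The class `𝒮*(ψ)`: all `f ∈ 𝒜` with `z f'(z) / f(z) ≺ ψ(z)`. -/
def starlikeClass (ψ : ℂ → ℂ) : Set (ℂ → ℂ) :=
  {f | IsNormalizedAnalytic f ∧ QuotientSubordinate (fun z => z * deriv f z) f ψ}

/-- The complex integral `∫₀ᶻ h(t) dt`, along the segment `t = s z`, `0 ≤ s ≤ 1`. -/
noncomputable def integralFromZero (h : ℂ → ℂ) (z : ℂ) : ℂ :=
  ∫ s in (0 : ℝ)..1, h ((s : ℂ) * z) * z

/-!
Let `F` be the analytic extension of `f f'' / f'²`, and let `p` and `q` be the radial averages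
`(1/z) ∫₀ᶻ F` and `(1/z) ∫₀ᶻ h`, so that `p + z p' = F ≺ h = q + z q'`. Since `(f / f')' = 1 - F`,
one has `f = z f' (1 - p)`.

The lower bound `-1/2` for `h` makes `q` a convex function: by Jack's lemma `2 q' / h' - 1` has
modulus less than `1`, that is `Re (h' / q') > 1`. So `h ∘ q⁻¹` has a derivative with positive real
part on the convex domain `q(𝔻)`, and its difference quotients have positive real part. If
`ω = q⁻¹ ∘ p` failed to satisfy `|ω(z)| ≤ |z|`, then at a maximum of `|ω|` on a closed disk
`|z| ≤ r` Jack's lemma would give `F = h(ω) + (m - 1) ω q'(ω)` with `m ≥ 1`, and such a point is not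
a value of `h` on the disk `|w| < |ω|`. Hence `p ≺ q ≺ (ψ - 1) / ψ`, which is to say
`z f' / f = 1 / (1 - p) ≺ ψ`.
-/

open Filter Topology ComplexConjugate

theorem ball_subset_of_forall_sphere_subset {X : Type*} [PseudoMetricSpace X] [ProperSpace X]
    {U : Set X} {x : X} {R : ℝ} (hU : IsOpen U) (hx : x ∈ U)
    (h : ∀ r, 0 < r → r < R → ball x r ⊆ U → sphere x r ⊆ U) : ball x R ⊆ U := by
  by_contra hsub
  obtain ⟨z, hz, hzU⟩ := not_subset.1 hsub
  obtain ⟨y, hyU, hy⟩ := hU.isClosed_compl.exists_infDist_eq_dist ⟨z, hzU⟩ x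
  have hball : ball x (dist y x) ⊆ U := by
    intro a ha
    by_contra haU
    have hle : dist x y ≤ dist x a := hy ▸ infDist_le_dist_of_mem haU
    rw [dist_comm x y, dist_comm x a] at hle
    exact hle.not_gt ha
  have hpos : 0 < dist y x := by
    obtain ⟨ε, hε, hεU⟩ := isOpen_iff.1 hU x hx
    exact hε.trans_le (not_lt.1 fun hlt => hyU (hεU hlt))
  have hlt : dist y x < R := by
    rw [dist_comm, ← hy]
    exact (infDist_le_dist_of_mem hzU).trans_lt (dist_comm x z ▸ hz)
  exact hyU (h _ hpos hlt hball rfl)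

/-! ### Jack's lemma -/

theorem re_mul_sub_one_nonpos_of_norm_le {u : ℂ → ℂ} {z₀ c : ℂ} (hu : DifferentiableAt ℂ u z₀)
    (hne : u z₀ ≠ 0) (hmax : ∀ z, ‖z‖ ≤ ‖z₀‖ → ‖u z‖ ≤ ‖u z₀‖) (hc : ‖c‖ ≤ 1) :
    (z₀ * deriv u z₀ / u z₀ * (c - 1)).re ≤ 0 := by
  have hre : HasFDerivAt (fun z => (u z / u z₀).re) _ z₀ :=
    Complex.reCLM.hasFDerivAt.comp z₀
      ((hu.hasDerivAt.div_const (u z₀)).hasFDerivAt.restrictScalars ℝ)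
  have hlocal : IsLocalMaxOn (fun z => (u z / u z₀).re) (closedBall 0 ‖z₀‖) z₀ := by
    refine IsMaxOn.localize fun z hz => ?_
    rw [mem_ofPred_eq, div_self hne, Complex.one_re]
    refine (Complex.re_le_norm _).trans ?_
    rw [norm_div]
    exact div_le_one_of_le₀ (hmax z (mem_closedBall_zero_iff.1 hz)) (norm_nonneg _)
  have hcone : z₀ * (c - 1) ∈ posTangentConeAt (closedBall 0 ‖z₀‖) z₀ := by
    refine mem_posTangentConeAt_of_segment_subset
      ((convex_closedBall (0 : ℂ) ‖z₀‖).segment_subset (by simp) ?_)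
    rw [mem_closedBall_zero_iff, show z₀ + z₀ * (c - 1) = z₀ * c by ring, norm_mul]
    exact mul_le_of_le_one_right (norm_nonneg _) hc
  rw [show z₀ * deriv u z₀ / u z₀ * (c - 1) = z₀ * (c - 1) * (deriv u z₀ / u z₀) by ring]
  exact hlocal.hasFDerivWithinAt_nonpos hre.hasFDerivWithinAt hcone

theorem exists_nonneg_mul_deriv_eq_of_norm_le {u : ℂ → ℂ} {z₀ : ℂ} (hu : DifferentiableAt ℂ u z₀)
    (hne : u z₀ ≠ 0) (hmax : ∀ z, ‖z‖ ≤ ‖z₀‖ → ‖u z‖ ≤ ‖u z₀‖) :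
    ∃ m : ℝ, 0 ≤ m ∧ z₀ * deriv u z₀ = m * u z₀ := by
  set a := z₀ * deriv u z₀ / u z₀ with ha
  have hnorm : ‖a‖ ≤ a.re := by
    -- the choice of `c` that makes `a * c = ‖a‖`
    have h := re_mul_sub_one_nonpos_of_norm_le hu hne hmax (c := conj a / ‖a‖)
      (by simpa using div_self_le_one ‖a‖)
    have hac : a * (conj a / ‖a‖) = (‖a‖ : ℂ) := by
      rw [← mul_div_assoc, Complex.mul_conj', sq, mul_self_div_self]
    rw [← ha, mul_sub, mul_one, hac, Complex.sub_re, Complex.ofReal_re] at h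
    linarith
  have hreal : (a.re : ℂ) = a :=
    Complex.ext rfl
      (Complex.abs_re_eq_norm.1 ((Complex.abs_re_le_norm a).antisymm
        (hnorm.trans (le_abs_self _)))).symm
  exact ⟨a.re, (norm_nonneg a).trans hnorm, by rw [hreal, ha, div_mul_cancel₀ _ hne]⟩

theorem mul_dslope_zero {v : ℂ → ℂ} (h0 : v 0 = 0) (z : ℂ) : z * dslope v 0 z = v z := by
  simpa [h0] using sub_smul_dslope v 0 z

theorem norm_dslope_zero_le_of_norm_le {v : ℂ → ℂ} {z₀ : ℂ}
    (hv : DifferentiableOn ℂ v (ball 0 ‖z₀‖)) (h0 : v 0 = 0) (hz₀ : z₀ ≠ 0)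
    (hmax : ∀ z, ‖z‖ ≤ ‖z₀‖ → ‖v z‖ ≤ ‖v z₀‖) {z : ℂ} (hz : ‖z‖ ≤ ‖z₀‖) :
    ‖dslope v 0 z‖ ≤ ‖dslope v 0 z₀‖ := by
  have hnorm : ∀ y, y ≠ 0 → ‖dslope v 0 y‖ = ‖v y‖ / ‖y‖ := fun y hy => by
    rw [← mul_dslope_zero h0 y, norm_mul, mul_div_cancel_left₀ _ (norm_ne_zero_iff.2 hy)]
  rw [hnorm z₀ hz₀]
  rcases hz.lt_or_eq with hlt | heq
  · refine Complex.norm_dslope_le_div_of_mapsTo_ball hv (fun y hy => ?_)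
      (mem_ball_zero_iff.2 hlt)
    rw [h0, mem_closedBall_zero_iff]
    exact hmax y (mem_ball_zero_iff.1 hy).le
  · rw [hnorm z (norm_ne_zero_iff.1 (heq ▸ norm_ne_zero_iff.2 hz₀)), heq]
    gcongr
    exact hmax z hz

theorem jack_lemma {v : ℂ → ℂ} {R : ℝ} {z₀ : ℂ} (hv : DifferentiableOn ℂ v (ball 0 R))
    (h0 : v 0 = 0) (hz₀ : ‖z₀‖ < R) (hne : v z₀ ≠ 0)
    (hmax : ∀ z, ‖z‖ ≤ ‖z₀‖ → ‖v z‖ ≤ ‖v z₀‖) :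
    ∃ m : ℝ, 1 ≤ m ∧ z₀ * deriv v z₀ = m * v z₀ := by
  have hvu := mul_dslope_zero h0
  have hud : DifferentiableAt ℂ (dslope v 0) z₀ :=
    ((Complex.differentiableOn_dslope (ball_mem_nhds 0 ((norm_nonneg _).trans_lt hz₀))).2 hv
      ).differentiableAt (isOpen_ball.mem_nhds (mem_ball_zero_iff.2 hz₀))
  obtain ⟨m, hm0, hm⟩ := exists_nonneg_mul_deriv_eq_of_norm_le hud
    (right_ne_zero_of_mul (hvu z₀ ▸ hne)) fun z => norm_dslope_zero_le_of_norm_le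
      (hv.mono (ball_subset_ball hz₀.le)) h0 (fun h => hne (h ▸ h0)) hmax
  have hderiv : deriv v z₀ = dslope v 0 z₀ + z₀ * deriv (dslope v 0) z₀ := by
    have h := (hasDerivAt_id' z₀).fun_mul hud.hasDerivAt
    simp only [hvu, one_mul] at h
    exact h.deriv
  refine ⟨1 + m, by linarith, ?_⟩
  rw [hderiv, hm, ← hvu z₀]
  push_cast
  ring

theorem mapsTo_ball_of_mul_deriv_ne {v : ℂ → ℂ} {R M : ℝ} (hv : DifferentiableOn ℂ v (ball 0 R))
    (h0 : v 0 = 0) (hM : 0 < M)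
    (h : ∀ z ∈ ball (0 : ℂ) R, ∀ m : ℝ, 1 ≤ m → ‖v z‖ = M → z * deriv v z ≠ m * v z) :
    MapsTo v (ball 0 R) (ball 0 M) := by
  rcases le_or_gt R 0 with hR | hR
  · simp [ball_eq_empty.2 hR, mapsTo_empty]
  suffices hsub : ball 0 R ⊆ ball 0 R ∩ v ⁻¹' ball 0 M from fun z hz => (hsub hz).2
  refine ball_subset_of_forall_sphere_subset (hv.continuousOn.isOpen_inter_preimage isOpen_ball
    isOpen_ball) ⟨mem_ball_self hR, by simpa [h0] using hM⟩ fun r hr hrR hball z hz => ?_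
  have hclosed : ∀ y, ‖y‖ ≤ r → ‖v y‖ ≤ M := by
    intro y hy
    rw [← mem_closedBall_zero_iff, ← closure_ball (0 : ℂ) hr.ne'] at hy
    refine le_on_closure (fun x hx => (mem_ball_zero_iff.1 (hball hx).2).le) ?_
      continuousOn_const hy
    rw [closure_ball (0 : ℂ) hr.ne']
    exact (hv.continuousOn.mono (closedBall_subset_ball hrR)).norm
  have hzr : ‖z‖ = r := mem_sphere_zero_iff_norm.1 hz
  have hzR : z ∈ ball 0 R := mem_ball_zero_iff.2 (hzr ▸ hrR)
  refine ⟨hzR, mem_ball_zero_iff.2 ((hclosed z hzr.le).lt_of_ne fun heq => ?_)⟩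
  obtain ⟨m, hm, hmv⟩ := jack_lemma hv h0 (hzr ▸ hrR) (norm_pos_iff.1 (heq ▸ hM))
    (fun y hy => (hclosed y (hy.trans hzr.le)).trans heq.ge)
  exact h z hzR m hm heq hmv

/-! ### Lower bounds on the logarithmic derivative -/

theorem conj_mul_eq_norm_sq_mul_div (w a : ℂ) : conj w * a = (‖w‖ ^ 2 : ℝ) * (a / w) := by
  rcases eq_or_ne w 0 with rfl | hw
  · simp
  · rw [← Complex.normSq_eq_norm_sq, ← Complex.mul_conj]
    field_simp

theorem ofReal_mul_mem_ball {z : ℂ} {R t : ℝ} (hz : z ∈ ball 0 R) (ht : t ∈ Icc (0 : ℝ) 1) :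
    (t : ℂ) * z ∈ ball (0 : ℂ) R := by
  rw [mem_ball_zero_iff, norm_mul, Complex.norm_of_nonneg ht.1]
  exact (mul_le_of_le_one_left (norm_nonneg z) ht.2).trans_lt (mem_ball_zero_iff.1 hz)

theorem hasDerivAt_ofReal_mul (z : ℂ) (t : ℝ) : HasDerivAt (fun t : ℝ => (t : ℂ) * z) z t := by
  simpa using (hasDerivAt_id t).ofReal_comp.mul_const z

theorem monotoneOn_pow_mul_norm_sq {k : ℂ → ℂ} {R C : ℝ} {n : ℕ}
    (hk : DifferentiableOn ℂ k (ball 0 R))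
    (hC : ∀ z ∈ ball (0 : ℂ) R, C ≤ (z * deriv k z / k z).re) (hn : -(2 * C) ≤ n) {z : ℂ}
    (hz : z ∈ ball 0 R) :
    MonotoneOn (fun t : ℝ => t ^ (n + 1) * ‖k (t * z)‖ ^ 2) (Icc 0 1) := by
  have hderiv : ∀ t ∈ Icc (0 : ℝ) 1, HasDerivAt (fun t : ℝ => t ^ (n + 1) * ‖k (t * z)‖ ^ 2)
      ((n + 1 : ℕ) * t ^ n * ‖k (t * z)‖ ^ 2
        + t ^ (n + 1) * (2 * inner ℝ (k (t * z)) (deriv k (t * z) * z))) t := fun t ht =>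
    (hasDerivAt_pow (n + 1) t).mul ((hk.differentiableAt (isOpen_ball.mem_nhds
      (ofReal_mul_mem_ball hz ht))).hasDerivAt.comp t (hasDerivAt_ofReal_mul z t)).norm_sq
  refine monotoneOn_of_hasDerivWithinAt_nonneg (convex_Icc 0 1)
    (fun t ht => (hderiv t ht).continuousAt.continuousWithinAt)
    (fun t ht => (hderiv t (interior_subset ht)).hasDerivWithinAt) fun t ht => ?_
  replace ht := interior_subset ht
  -- This also holds where `k` vanishes, although the quotient is then the junk value `0`.
  have hinner : t * inner ℝ (k (t * z)) (deriv k (t * z) * z)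
      = ‖k (t * z)‖ ^ 2 * (t * z * deriv k (t * z) / k (t * z)).re := by
    rw [← Complex.re_ofReal_mul, ← conj_mul_eq_norm_sq_mul_div, Complex.inner,
      ← Complex.re_ofReal_mul]
    ring_nf
  calc 0 ≤ t ^ n * (‖k (t * z)‖ ^ 2 * (n + 1 + 2 * (t * z * deriv k (t * z) / k (t * z)).re)) :=
        mul_nonneg (pow_nonneg ht.1 n) (mul_nonneg (sq_nonneg _)
          (by linarith [hC _ (ofReal_mul_mem_ball hz ht)]))
    _ = _ := by push_cast; linear_combination (-2 * t ^ n) * hinner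

theorem ne_zero_of_le_re_mul_deriv_div {k : ℂ → ℂ} {R C : ℝ} (hk : DifferentiableOn ℂ k (ball 0 R))
    (h0 : k 0 ≠ 0) (hC : ∀ z ∈ ball (0 : ℂ) R, C ≤ (z * deriv k z / k z).re) {z : ℂ}
    (hz : z ∈ ball 0 R) : k z ≠ 0 := by
  obtain ⟨n, hn⟩ := exists_nat_ge (-(2 * C))
  have hcont : ContinuousAt (fun t : ℝ => k (t * z)) 0 := by
    refine ContinuousAt.comp ?_ (by fun_prop)
    simpa using (hk.differentiableAt (ball_mem_nhds 0 (pos_of_mem_ball hz))).continuousAt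
  obtain ⟨t, hkt, ht⟩ := (((hcont.eventually_ne (by simpa using h0)).filter_mono
    nhdsWithin_le_nhds).and (Ioo_mem_nhdsGT one_pos)).exists
  have hle := monotoneOn_pow_mul_norm_sq hk hC hn hz ⟨ht.1.le, ht.2.le⟩ ⟨zero_le_one, le_rfl⟩
    ht.2.le
  have hpos : 0 < t ^ (n + 1) * ‖k (t * z)‖ ^ 2 :=
    mul_pos (pow_pos ht.1 _) (pow_pos (norm_pos_iff.2 hkt) 2)
  exact fun hkz => hpos.not_ge (hle.trans_eq (by simp [hkz]))

theorem re_inv_one_add {u : ℂ} (hu : 1 + u ≠ 0) :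
    ((1 + u)⁻¹).re = 1 / 2 + (1 - ‖u‖ ^ 2) / (2 * ‖1 + u‖ ^ 2) := by
  have hn : Complex.normSq (1 + u) ≠ 0 := Complex.normSq_eq_zero.not.2 hu
  have hexpand : Complex.normSq (1 + u) = 1 + 2 * u.re + Complex.normSq u := by
    simp only [Complex.normSq_add, Complex.normSq_one, one_mul, Complex.conj_re]
    ring
  rw [Complex.inv_re, ← Complex.normSq_eq_norm_sq, ← Complex.normSq_eq_norm_sq, Complex.add_re,
    Complex.one_re]
  field_simp
  rw [hexpand]
  ring

theorem half_lt_re_inv_one_add {u : ℂ} (hu : ‖u‖ < 1) : 1 / 2 < ((1 + u)⁻¹).re := by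
  have hne : 1 + u ≠ 0 := fun h => by
    rw [eq_neg_of_add_eq_zero_right h, norm_neg, norm_one] at hu
    exact hu.false
  have hpos : 0 < 1 - ‖u‖ ^ 2 := sub_pos.2 (pow_lt_one₀ (norm_nonneg u) hu two_ne_zero)
  have := norm_pos_iff.2 hne
  rw [re_inv_one_add hne]
  exact lt_add_of_pos_right _ (by positivity)

theorem re_le_of_mul_add_mul_two_add_eq_two {u Q : ℂ} {m : ℝ} (hu : ‖u‖ = 1) (hm : 1 ≤ m)
    (h : m * u + (1 + u) * (2 + Q) = 2) : Q.re ≤ -(3 / 2) := by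
  have hne : 1 + u ≠ 0 := by
    intro h0
    rw [h0, zero_mul, add_zero, eq_neg_of_add_eq_zero_right h0] at h
    have := congrArg Complex.re h
    norm_num at this
    linarith
  have hQ : Q = ((2 + m : ℝ) : ℂ) * (1 + u)⁻¹ - (m + 2 : ℝ) := by
    push_cast
    field_simp
    linear_combination h
  rw [hQ, Complex.sub_re, Complex.re_ofReal_mul, Complex.ofReal_re, re_inv_one_add hne, hu, one_pow,
    sub_self, zero_div]
  linarith

theorem norm_two_mul_div_sub_one_lt_one {k r : ℂ → ℂ} {R : ℝ} (hk : DifferentiableOn ℂ k (ball 0 R))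
    (hr : DifferentiableOn ℂ r (ball 0 R)) (hne : ∀ z ∈ ball 0 R, k z ≠ 0)
    (hkr : ∀ z ∈ ball 0 R, k z = 2 * r z + z * deriv r z)
    (hre : ∀ z ∈ ball 0 R, -(3 / 2) < (z * deriv k z / k z).re) {z : ℂ} (hz : z ∈ ball 0 R) :
    ‖2 * r z / k z - 1‖ < 1 := by
  set v : ℂ → ℂ := fun z => 2 * r z / k z - 1
  have hv : ∀ z ∈ ball 0 R,
      HasDerivAt v ((2 * deriv r z * k z - 2 * r z * deriv k z) / k z ^ 2) z := fun z hz =>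
    ((((hr.differentiableAt (isOpen_ball.mem_nhds hz)).hasDerivAt.const_mul 2).div
      (hk.differentiableAt (isOpen_ball.mem_nhds hz)).hasDerivAt (hne z hz)).sub_const 1)
  have hode : ∀ z ∈ ball 0 R,
      z * deriv v z + (1 + v z) * (2 + z * deriv k z / k z) = 2 := fun z hz => by
    have := hne z hz
    rw [(hv z hz).deriv]
    simp only [v]
    field_simp
    linear_combination (-2 * k z) * hkr z hz
  have hR : 0 ∈ ball (0 : ℂ) R := mem_ball_self (pos_of_mem_ball hz)
  have hv0 : v 0 = 0 := by
    have h0 : k 0 = 2 * r 0 := by simpa using hkr 0 hR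
    simp only [v, ← h0, div_self (hne 0 hR), sub_self]
  refine mem_ball_zero_iff.1 (mapsTo_ball_of_mul_deriv_ne
    (fun z hz => (hv z hz).differentiableAt.differentiableWithinAt) hv0 one_pos
    (fun y hy m hm hvy heq => (hre y hy).not_ge ?_) hz)
  exact re_le_of_mul_add_mul_two_add_eq_two hvy hm (heq ▸ hode y hy)

theorem one_lt_re_div {k r : ℂ → ℂ} {R : ℝ} (hk : DifferentiableOn ℂ k (ball 0 R))
    (hr : DifferentiableOn ℂ r (ball 0 R)) (hne : ∀ z ∈ ball 0 R, k z ≠ 0)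
    (hkr : ∀ z ∈ ball 0 R, k z = 2 * r z + z * deriv r z)
    (hre : ∀ z ∈ ball 0 R, -(3 / 2) < (z * deriv k z / k z).re) {z : ℂ} (hz : z ∈ ball 0 R) :
    1 < (k z / r z).re := by
  have h := half_lt_re_inv_one_add (norm_two_mul_div_sub_one_lt_one hk hr hne hkr hre hz)
  rw [add_sub_cancel, inv_div, mul_comm, ← div_div, Complex.div_ofNat_re] at h
  linarith

/-! ### Radial averages -/

/-- The mean of `h` over the segment from `0` to `z`, that is `(1/z) ∫₀ᶻ h(t) dt` with its
singularity at `0` filled in, by the substitution `t = s z`. -/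
noncomputable def radialAverage (h : ℂ → ℂ) (z : ℂ) : ℂ :=
  ∫ s in (0 : ℝ)..1, h (s * z)

theorem radialAverage_zero (h : ℂ → ℂ) : radialAverage h 0 = h 0 := by
  simp [radialAverage]

theorem integralFromZero_eq_mul_radialAverage (h : ℂ → ℂ) (z : ℂ) :
    integralFromZero h z = z * radialAverage h z := by
  rw [integralFromZero, intervalIntegral.integral_mul_const, mul_comm, radialAverage]

theorem mul_radialAverage_eq_sub {h H : ℂ → ℂ} {R : ℝ} (hh : ContinuousOn h (ball 0 R))
    (hH : ∀ z ∈ ball 0 R, HasDerivAt H (h z) z) {z : ℂ} (hz : z ∈ ball 0 R) :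
    z * radialAverage h z = H z - H 0 := by
  have hseg : ∀ s ∈ uIcc (0 : ℝ) 1, (s : ℂ) * z ∈ ball (0 : ℂ) R := fun s hs =>
    ofReal_mul_mem_ball hz (uIcc_of_le (zero_le_one' ℝ) ▸ hs)
  have hftc := intervalIntegral.integral_eq_sub_of_hasDerivAt
    (fun s hs => (hH _ (hseg s hs)).comp s (hasDerivAt_ofReal_mul z s))
    ((hh.comp (by fun_prop) hseg).mul continuousOn_const).intervalIntegrable
  rw [← integralFromZero_eq_mul_radialAverage, integralFromZero]
  simpa using hftc

theorem differentiableOn_radialAverage {h : ℂ → ℂ} {R : ℝ} (hh : DifferentiableOn ℂ h (ball 0 R)) :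
    DifferentiableOn ℂ (radialAverage h) (ball 0 R) := by
  rcases le_or_gt R 0 with hR | hR
  · simpa only [ball_eq_empty.2 hR] using differentiableOn_empty
  obtain ⟨H, hH⟩ := hh.isExactOn_ball
  have hslope : EqOn (radialAverage h) (dslope H 0) (ball 0 R) := fun z hz => by
    rcases eq_or_ne z 0 with rfl | hz0
    · rw [dslope_same, (hH 0 hz).deriv, radialAverage_zero]
    · rw [dslope_of_ne H hz0, slope_def_field, ← mul_radialAverage_eq_sub hh.continuousOn hH hz,
        sub_zero, mul_div_cancel_left₀ _ hz0]
  exact ((Complex.differentiableOn_dslope (ball_mem_nhds 0 hR)).2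
    fun z hz => (hH z hz).differentiableAt.differentiableWithinAt).congr hslope

theorem radialAverage_add_mul_deriv {h : ℂ → ℂ} {R : ℝ} (hh : DifferentiableOn ℂ h (ball 0 R))
    {z : ℂ} (hz : z ∈ ball 0 R) :
    radialAverage h z + z * deriv (radialAverage h) z = h z := by
  obtain ⟨H, hH⟩ := hh.isExactOn_ball
  have hprod := (hasDerivAt_id' z).fun_mul
    ((differentiableOn_radialAverage hh).differentiableAt (isOpen_ball.mem_nhds hz)).hasDerivAt
  rw [one_mul] at hprod
  refine (hprod.congr_of_eventuallyEq ?_).unique (hH z hz |>.sub_const (H 0))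
  filter_upwards [isOpen_ball.mem_nhds hz] with y hy
  exact (mul_radialAverage_eq_sub hh.continuousOn hH hy).symm

theorem deriv_eq_of_eq_add_mul_deriv {h q : ℂ → ℂ} {U : Set ℂ} (hU : IsOpen U)
    (hq : DifferentiableOn ℂ q U) (hhq : ∀ z ∈ U, h z = q z + z * deriv q z) {z : ℂ} (hz : z ∈ U) :
    deriv h z = 2 * deriv q z + z * deriv (deriv q) z := by
  have hq' := (hq.differentiableAt (hU.mem_nhds hz)).hasDerivAt
  have hq'' := ((hq.deriv hU).differentiableAt (hU.mem_nhds hz)).hasDerivAt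
  have hsum := hq'.add ((hasDerivAt_id' z).fun_mul hq'')
  rw [(hsum.congr_of_eventuallyEq (EqOn.eventuallyEq_of_mem hhq (hU.mem_nhds hz))).deriv]
  ring

/-- Convex univalent functions on the unit disk, through the classical analytic characterization:
`q` is locally univalent and `Re (1 + z q''(z) / q'(z)) > 0`. -/
structure IsConvexFunction (q : ℂ → ℂ) : Prop where
  analytic : AnalyticOnNhd ℂ q (ball 0 1)
  deriv_ne_zero : ∀ z ∈ ball (0 : ℂ) 1, deriv q z ≠ 0
  re_pos : ∀ z ∈ ball (0 : ℂ) 1, 0 < (1 + z * deriv (deriv q) z / deriv q z).re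

theorem isConvexFunction_radialAverage {h : ℂ → ℂ} (hh : AnalyticOnNhd ℂ h (ball 0 1))
    (hh1 : deriv h 0 ≠ 0)
    (hre : ∀ z ∈ ball (0 : ℂ) 1, -(1 / 2) < (1 + z * deriv (deriv h) z / deriv h z).re) :
    IsConvexFunction (radialAverage h) := by
  set q := radialAverage h
  have hq : DifferentiableOn ℂ q (ball 0 1) := differentiableOn_radialAverage hh.differentiableOn
  have hq' : DifferentiableOn ℂ (deriv q) (ball 0 1) := hq.deriv isOpen_ball
  have hh' : DifferentiableOn ℂ (deriv h) (ball 0 1) := hh.differentiableOn.deriv isOpen_ball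
  have hre' : ∀ z ∈ ball (0 : ℂ) 1, -(3 / 2) < (z * deriv (deriv h) z / deriv h z).re :=
    fun z hz => by
      have := hre z hz
      rw [Complex.add_re, Complex.one_re] at this
      linarith
  have hne : ∀ z ∈ ball (0 : ℂ) 1, deriv h z ≠ 0 := fun z =>
    ne_zero_of_le_re_mul_deriv_div hh' hh1 fun z hz => (hre' z hz).le
  have hhq : ∀ z ∈ ball (0 : ℂ) 1, deriv h z = 2 * deriv q z + z * deriv (deriv q) z := fun z =>
    deriv_eq_of_eq_add_mul_deriv isOpen_ball hq
      fun z hz => (radialAverage_add_mul_deriv hh.differentiableOn hz).symm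
  have hlt : ∀ z ∈ ball (0 : ℂ) 1, 1 < (deriv h z / deriv q z).re := fun z =>
    one_lt_re_div hh' hq' hne hhq hre'
  have hqne : ∀ z ∈ ball (0 : ℂ) 1, deriv q z ≠ 0 := fun z hz hqz => by
    simpa [hqz] using (zero_lt_one.trans (hlt z hz)).ne'
  refine ⟨hq.analyticOnNhd isOpen_ball, hqne, fun z hz => ?_⟩
  have hdiv : deriv h z / deriv q z = 1 + (1 + z * deriv (deriv q) z / deriv q z) := by
    rw [hhq z hz]
    field_simp [hqne z hz]
    ring
  have := hlt z hz
  rw [hdiv, Complex.add_re, Complex.one_re] at this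
  linarith

/-! ### Convex functions -/

theorem exists_hasDerivAt_eq_mul_exp {k : ℂ → ℂ} {c ζ : ℂ} {R : ℝ}
    (hk : DifferentiableOn ℂ k (ball c R)) (hne : ∀ z ∈ ball c R, k z ≠ 0) (hζ : ζ ∈ ball c R) :
    ∃ g : ℂ → ℂ, g ζ = 0 ∧ (∀ z ∈ ball c R, HasDerivAt g (deriv k z / k z) z) ∧
      ∀ z ∈ ball c R, k z = k ζ * Complex.exp (g z) := by
  obtain ⟨g, hgζ, hg⟩ :=
    ((hk.deriv isOpen_ball).fun_div hk hne).isExactOn_ball.with_val_at ζ 0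
  have hd : ∀ z ∈ ball c R, HasDerivAt (fun z => k z * Complex.exp (-g z)) 0 z := fun z hz => by
    convert! (hk.differentiableAt (isOpen_ball.mem_nhds hz)).hasDerivAt.fun_mul
      (hg z hz).fun_neg.cexp using 1
    field_simp [hne z hz]
    ring
  refine ⟨g, hgζ, hg, fun z hz => ?_⟩
  have hconst := isOpen_ball.is_const_of_deriv_eq_zero (convex_ball c R).isPreconnected
    (fun z hz => (hd z hz).differentiableAt.differentiableWithinAt)
    (fun z hz => (hd z hz).deriv) hz hζ
  simp only [hgζ, neg_zero, Complex.exp_zero, mul_one] at hconst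
  rw [← hconst, mul_assoc, ← Complex.exp_add, neg_add_cancel, Complex.exp_zero, mul_one]

theorem pos_of_hasDerivAt_mul_sin {φ ρ A : ℝ → ℝ} {a b s : ℝ} (hs : s ∈ Ioo a b)
    (hφ : ∀ t, HasDerivAt φ (ρ t * Real.sin (A t)) t) (hρ : ∀ t, 0 < ρ t) (hA : StrictMono A)
    (hAa : A a = 0) (hAb : A b = 2 * Real.pi) (hφa : φ a = 0) (hφb : φ b = 0) : 0 < φ s := by
  -- `φ` increases while `A ≤ π` and decreases afterwards.
  have hcont : Continuous φ := continuous_iff_continuousAt.2 fun t => (hφ t).continuousAt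
  rcases le_or_gt (A s) Real.pi with hle | hgt
  · have hmono : StrictMonoOn φ (Icc a s) := by
      refine strictMonoOn_of_deriv_pos (convex_Icc _ _) hcont.continuousOn fun x hx => ?_
      rw [interior_Icc] at hx
      rw [(hφ x).deriv]
      exact mul_pos (hρ x) (Real.sin_pos_of_pos_of_lt_pi (hAa ▸ hA hx.1) ((hA hx.2).trans_le hle))
    exact hφa ▸ hmono ⟨le_rfl, hs.1.le⟩ ⟨hs.1.le, le_rfl⟩ hs.1
  · have hanti : StrictAntiOn φ (Icc s b) := by
      refine strictAntiOn_of_deriv_neg (convex_Icc _ _) hcont.continuousOn fun x hx => ?_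
      rw [interior_Icc] at hx
      rw [(hφ x).deriv, ← Real.sin_sub_two_pi]
      have hA₁ : Real.pi < A x := hgt.trans (hA hx.1)
      have hA₂ : A x < 2 * Real.pi := hAb ▸ hA hx.2
      exact mul_neg_of_pos_of_neg (hρ x)
        (Real.sin_neg_of_neg_of_neg_pi_lt (by linarith) (by linarith))
    exact hφb ▸ hanti ⟨le_rfl, hs.2.le⟩ ⟨hs.2.le, le_rfl⟩ hs.2

theorem strictMono_add_im_circleMap {g g' : ℂ → ℂ} {r : ℝ} (hr : 0 ≤ r)
    (hg : ∀ z ∈ sphere (0 : ℂ) r, HasDerivAt g (g' z) z)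
    (hpos : ∀ z ∈ sphere (0 : ℂ) r, 0 < (1 + z * g' z).re) :
    StrictMono fun t => t + (g (circleMap 0 r t)).im := by
  have hmem := circleMap_mem_sphere (0 : ℂ) hr
  refine strictMono_of_hasDerivAt_pos (fun t => ?_) fun t => hpos _ (hmem t)
  have him : HasDerivAt (fun t => (g (circleMap 0 r t)).im) _ t :=
    Complex.imCLM.hasFDerivAt.comp_hasDerivAt t
      ((hg _ (hmem t)).comp t (hasDerivAt_circleMap 0 r t))
  convert! (hasDerivAt_id t).fun_add him using 1
  simp only [Complex.add_re, Complex.one_re, Complex.mul_re, Complex.imCLM_apply, Complex.mul_im,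
    Complex.I_im, mul_one, Complex.I_re, mul_zero, add_zero, zero_sub, mul_neg, add_right_inj]
  ring

theorem hasDerivAt_re_sub_div_circleMap {q g : ℂ → ℂ} {d : ℂ} {r a t : ℝ} (hr : r ≠ 0) (hd : d ≠ 0)
    (hq : HasDerivAt q (d * Complex.exp (g (circleMap 0 r t))) (circleMap 0 r t)) :
    HasDerivAt
      (fun t => ((q (circleMap 0 r a) - q (circleMap 0 r t)) / (circleMap 0 r a * d)).re)
      (Real.exp (g (circleMap 0 r t)).re * Real.sin (t + (g (circleMap 0 r t)).im - a)) t := by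
  have hre : HasDerivAt
      (fun t => ((q (circleMap 0 r a) - q (circleMap 0 r t)) / (circleMap 0 r a * d)).re) _ t :=
    Complex.reCLM.hasFDerivAt.comp_hasDerivAt t (((hq.comp t (hasDerivAt_circleMap 0 r t)).const_sub
      (q (circleMap 0 r a))).div_const (circleMap 0 r a * d))
  convert! hre using 1
  have hexp : -(d * Complex.exp (g (circleMap 0 r t)) * (circleMap 0 r t * Complex.I))
        / (circleMap 0 r a * d)
      = -(Complex.I * Complex.exp (g (circleMap 0 r t) + (t - a : ℝ) * Complex.I)) := by
    rw [Complex.exp_add, Complex.ofReal_sub, sub_mul, Complex.exp_sub]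
    simp only [circleMap_zero]
    have := Complex.ofReal_ne_zero.2 hr
    field_simp
  rw [hexp]
  simp only [Complex.ofReal_sub, Complex.reCLM_apply, Complex.neg_re, Complex.mul_re, Complex.I_re,
    zero_mul, Complex.I_im, Complex.exp_im, Complex.add_re, Complex.sub_re, Complex.ofReal_re,
    mul_zero, Complex.sub_im, Complex.ofReal_im, sub_self, mul_one, add_zero, Complex.add_im,
    Complex.mul_im, one_mul, zero_sub, neg_neg, mul_eq_mul_left_iff, Real.exp_ne_zero, or_false]
  ring_nf

namespace IsConvexFunction

variable {q : ℂ → ℂ} {w ζ : ℂ}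

theorem re_sub_div_pos_of_norm_eq (hq : IsConvexFunction q) (hζ : ζ ∈ ball 0 1) (hw : ‖w‖ = ‖ζ‖)
    (hne : w ≠ ζ) : 0 < ((q ζ - q w) / (ζ * deriv q ζ)).re := by
  have hr : 0 < ‖ζ‖ := norm_pos_iff.2 fun h0 => hne (by simpa [h0] using hw)
  have hsphere : sphere (0 : ℂ) ‖ζ‖ ⊆ ball 0 1 := sphere_subset_ball (mem_ball_zero_iff.1 hζ)
  obtain ⟨g, hgζ, hg, hexp⟩ := exists_hasDerivAt_eq_mul_exp
    (hq.analytic.differentiableOn.deriv isOpen_ball) hq.deriv_ne_zero hζ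
  set γ := circleMap 0 ‖ζ‖
  have hγa : γ (Complex.arg ζ) = ζ := by simp [γ, circleMap_zero, Complex.norm_mul_exp_arg_mul_I]
  have hγb : γ (Complex.arg ζ + 2 * Real.pi) = ζ := (periodic_circleMap _ _ _).trans hγa
  have hγmem : ∀ t, γ t ∈ ball 0 1 := fun t => hsphere (circleMap_mem_sphere 0 hr.le t)
  obtain ⟨s, hs, rfl⟩ : w ∈ γ '' Ioc (Complex.arg ζ) (Complex.arg ζ + 2 * Real.pi) := by
    rw [(periodic_circleMap 0 ‖ζ‖).image_Ioc Real.two_pi_pos, range_circleMap, abs_of_pos hr]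
    exact mem_sphere_zero_iff_norm.2 hw
  have hmono := strictMono_add_im_circleMap hr.le (fun z hz => hg z (hsphere hz)) fun z hz => by
    simpa only [mul_div_assoc] using hq.re_pos z (hsphere hz)
  set φ : ℝ → ℝ := fun t => ((q ζ - q (γ t)) / (ζ * deriv q ζ)).re with hφ
  have hderiv : ∀ t, HasDerivAt φ
      (Real.exp (g (γ t)).re * Real.sin (t + (g (γ t)).im - Complex.arg ζ)) t := fun t => by
    have hqt := (hq.analytic _ (hγmem t)).differentiableAt.hasDerivAt
    rw [hexp _ (hγmem t)] at hqt
    have h := hasDerivAt_re_sub_div_circleMap (a := Complex.arg ζ) hr.ne'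
      (hq.deriv_ne_zero ζ hζ) hqt
    rwa [show circleMap 0 ‖ζ‖ (Complex.arg ζ) = ζ from hγa] at h
  refine pos_of_hasDerivAt_mul_sin (φ := φ) ⟨hs.1, hs.2.lt_of_ne fun h => hne (h ▸ hγb)⟩ hderiv
    (fun t => Real.exp_pos _) (fun _ _ ht => sub_lt_sub_right (hmono ht) _) ?_ ?_ ?_ ?_ <;>
  simp [hφ, hγa, hγb, hgζ]

end IsConvexFunction

theorem re_pos_of_forall_sphere_re_nonneg {u : ℂ → ℂ} {c y z : ℂ} {r : ℝ}
    (hu : DiffContOnCl ℂ u (ball c r)) (hnonneg : ∀ x ∈ sphere c r, 0 ≤ (u x).re)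
    (hy : y ∈ sphere c r) (hpos : 0 < (u y).re) (hz : z ∈ ball c r) : 0 < (u z).re := by
  have hr : r ≠ 0 := (pos_of_mem_ball hz).ne'
  set v : ℂ → ℂ := fun x => Complex.exp (-u x)
  have hv : DiffContOnCl ℂ v (ball c r) := Complex.differentiable_exp.comp_diffContOnCl hu.neg
  have hnorm : ∀ x, ‖v x‖ = Real.exp (-(u x).re) := fun x => by
    rw [Complex.norm_exp, Complex.neg_re]
  have hle : ∀ x ∈ closure (ball c r), ‖v x‖ ≤ 1 := fun x =>
    Complex.norm_le_of_forall_mem_frontier_norm_le isBounded_ball hv fun x hx => by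
      rw [frontier_ball c hr] at hx
      rw [hnorm, Real.exp_le_one_iff, neg_nonpos]
      exact hnonneg x hx
  suffices hlt : ‖v z‖ < 1 by rwa [hnorm, Real.exp_lt_one_iff, neg_lt_zero] at hlt
  refine (hle z (subset_closure hz)).lt_of_ne fun heq => ?_
  have hconst := Complex.norm_eqOn_closure_of_isPreconnected_of_isMaxOn
    (convex_ball c r).isPreconnected isOpen_ball hv hz
    (fun x hx => (hle x (subset_closure hx)).trans heq.ge)
    (closure_ball c hr ▸ sphere_subset_closedBall hy)
  simp only [Function.comp_apply, Function.const_apply, heq, hnorm, Real.exp_eq_one_iff,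
    neg_eq_zero] at hconst
  exact hpos.ne' hconst

theorem isOpen_image_of_deriv_ne_zero {f : ℂ → ℂ} {U : Set ℂ} (hU : IsOpen U)
    (hf : DifferentiableOn ℂ f U) (hne : ∀ z ∈ U, deriv f z ≠ 0) : IsOpen (f '' U) := by
  refine isOpen_iff_mem_nhds.2 ?_
  rintro _ ⟨z, hz, rfl⟩
  rw [← (hf.analyticAt (hU.mem_nhds hz)).hasStrictDerivAt.map_nhds_eq (hne z hz)]
  exact image_mem_map (hU.mem_nhds hz)

theorem hasDerivAt_invFunOn {f : ℂ → ℂ} {U : Set ℂ} {z : ℂ} (hU : IsOpen U)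
    (hf : DifferentiableOn ℂ f U) (hinj : InjOn f U) (hz : z ∈ U) (hne : deriv f z ≠ 0) :
    HasDerivAt (Function.invFunOn f U) (deriv f z)⁻¹ (f z) :=
  ((hf.analyticAt (hU.mem_nhds hz)).hasStrictDerivAt.to_local_left_inverse hne
    (eventually_of_mem (hU.mem_nhds hz) hinj.leftInvOn_invFunOn)).hasDerivAt

namespace IsConvexFunction

variable {q : ℂ → ℂ} {w ζ : ℂ}

theorem re_sub_div_pos_of_norm_le (hq : IsConvexFunction q) (hζ : ζ ∈ ball 0 1) (hw : ‖w‖ ≤ ‖ζ‖)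
    (hne : w ≠ ζ) : 0 < ((q ζ - q w) / (ζ * deriv q ζ)).re := by
  rcases hw.eq_or_lt with heq | hlt
  · exact hq.re_sub_div_pos_of_norm_eq hζ heq hne
  have hr : ‖ζ‖ ≠ 0 := ((norm_nonneg w).trans_lt hlt).ne'
  set u : ℂ → ℂ := fun w => (q ζ - q w) / (ζ * deriv q ζ) with hu
  have hdiff : DiffContOnCl ℂ u (ball 0 ‖ζ‖) := by
    refine (((hq.analytic.differentiableOn.mono ?_).const_sub (q ζ)).div_const _).diffContOnCl
    rw [closure_ball 0 hr]
    exact closedBall_subset_ball (mem_ball_zero_iff.1 hζ)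
  refine re_pos_of_forall_sphere_re_nonneg (u := u) hdiff (fun x hx => ?_) (y := -ζ) (by simp)
    (hq.re_sub_div_pos_of_norm_eq hζ (norm_neg ζ) fun h => hr (norm_eq_zero.2 (neg_eq_self.1 h)))
    (mem_ball_zero_iff.2 hlt)
  rcases eq_or_ne x ζ with rfl | hxζ
  · simp [hu]
  · exact (hq.re_sub_div_pos_of_norm_eq hζ (mem_sphere_zero_iff_norm.1 hx) hxζ).le

theorem injOn (hq : IsConvexFunction q) : InjOn q (ball 0 1) := by
  intro a ha b hb hab
  wlog hle : ‖a‖ ≤ ‖b‖ generalizing a b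
  · exact (this hb ha hab.symm (le_of_not_ge hle)).symm
  by_contra hne
  simpa [hab] using hq.re_sub_div_pos_of_norm_le hb hle hne

theorem isOpen_image (hq : IsConvexFunction q) : IsOpen (q '' ball 0 1) :=
  isOpen_image_of_deriv_ne_zero isOpen_ball hq.analytic.differentiableOn hq.deriv_ne_zero

theorem notMem_segment (hq : IsConvexFunction q) {a b : ℂ} (hζ : ζ ∈ ball 0 1) (ha : ‖a‖ < ‖ζ‖)
    (hb : ‖b‖ < ‖ζ‖) : q ζ ∉ segment ℝ (q a) (q b) := by
  set ℓ : ℂ →ₗ[ℝ] ℝ := Complex.reLm ∘ₗ LinearMap.mulRight ℝ (ζ * deriv q ζ)⁻¹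
  have hlt : ∀ y, ‖y‖ < ‖ζ‖ → ℓ (q y) < ℓ (q ζ) := fun y hy => by
    have h := hq.re_sub_div_pos_of_norm_le hζ hy.le fun h => hy.ne (congrArg norm h)
    rwa [sub_div, Complex.sub_re, sub_pos] at h
  intro hseg
  have hself : ℓ (q ζ) < ℓ (q ζ) :=
    (convex_halfSpace_lt ℓ.isLinear _).segment_subset (hlt a ha) (hlt b hb) hseg
  exact hself.false

theorem convex_image (hq : IsConvexFunction q) : Convex ℝ (q '' ball 0 1) := by
  rw [convex_iff_segment_subset]
  rintro _ ⟨a, ha, rfl⟩ _ ⟨b, hb, rfl⟩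
  obtain ⟨ρ, hρ, hρ1⟩ := exists_between
    (max_lt (mem_ball_zero_iff.1 ha) (mem_ball_zero_iff.1 hb))
  have haρ : ‖a‖ < ρ := (le_max_left _ _).trans_lt hρ
  have hbρ : ‖b‖ < ρ := (le_max_right _ _).trans_lt hρ
  have hclosedBall : closedBall (0 : ℂ) ρ ⊆ ball 0 1 := closedBall_subset_ball hρ1
  have hball : ball (0 : ℂ) ρ ⊆ ball 0 1 := ball_subset_ball hρ1.le
  have hopen : IsOpen (q '' ball 0 ρ) := isOpen_image_of_deriv_ne_zero isOpen_ball
    (hq.analytic.differentiableOn.mono hball) fun z hz => hq.deriv_ne_zero z (hball hz)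
  have hclosed : IsClosed (q '' closedBall 0 ρ) := ((isCompact_closedBall _ _).image_of_continuousOn
    (hq.analytic.continuousOn.mono hclosedBall)).isClosed
  suffices hseg : segment ℝ (q a) (q b) ⊆ q '' ball 0 ρ from hseg.trans (image_mono hball)
  refine (convex_segment (q a) (q b)).isPreconnected.subset_of_closure_inter_subset hopen
    ⟨q a, left_mem_segment _ _ _, a, mem_ball_zero_iff.2 haρ, rfl⟩ ?_
  rintro x ⟨hx, hxseg⟩
  obtain ⟨ζ, hζ, rfl⟩ := closure_minimal (image_mono ball_subset_closedBall) hclosed hx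
  refine ⟨ζ, mem_ball_zero_iff.2 (not_le.1 fun hρζ => ?_), rfl⟩
  exact hq.notMem_segment (hclosedBall hζ) (haρ.trans_le hρζ) (hbρ.trans_le hρζ) hxseg

end IsConvexFunction

/-! ### Subordination to a convex function -/

theorem re_sub_div_sub_pos_of_re_deriv_pos {k k' : ℂ → ℂ} {Ω : Set ℂ} (hΩ : Convex ℝ Ω)
    (hk : ∀ y ∈ Ω, HasDerivAt k (k' y) y) (hpos : ∀ y ∈ Ω, 0 < (k' y).re) {a b : ℂ}
    (ha : a ∈ Ω) (hb : b ∈ Ω) (hab : a ≠ b) : 0 < ((k b - k a) / (b - a)).re := by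
  have hne : b - a ≠ 0 := sub_ne_zero.2 hab.symm
  have hmem : ∀ t ∈ Icc (0 : ℝ) 1, AffineMap.lineMap a b t ∈ Ω := fun t ht =>
    hΩ.lineMap_mem ha hb ht
  have hderiv : ∀ t ∈ Icc (0 : ℝ) 1, HasDerivAt
      (fun t : ℝ => (k (AffineMap.lineMap a b t) / (b - a)).re)
      (k' (AffineMap.lineMap a b t)).re t := fun t ht => by
    have h := ((hk _ (hmem t ht)).comp t AffineMap.hasDerivAt_lineMap).div_const (b - a)
    rw [mul_div_cancel_right₀ _ hne] at h
    exact Complex.reCLM.hasFDerivAt.comp_hasDerivAt t h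
  obtain ⟨t, ht, hslope⟩ := exists_hasDerivAt_eq_slope _ _ zero_lt_one
    (fun t ht => (hderiv t ht).continuousAt.continuousWithinAt)
    fun t ht => hderiv t (Ioo_subset_Icc_self ht)
  rw [AffineMap.lineMap_apply_one, AffineMap.lineMap_apply_zero, sub_zero, div_one,
    ← Complex.sub_re, ← sub_div] at hslope
  exact hslope ▸ hpos _ (hmem t (Ioo_subset_Icc_self ht))

namespace IsConvexFunction

variable {q : ℂ → ℂ}

theorem re_deriv_add_mul_deriv_div_pos (hq : IsConvexFunction q) {z : ℂ} (hz : z ∈ ball 0 1) :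
    0 < (deriv (fun z => q z + z * deriv q z) z / deriv q z).re := by
  rw [deriv_eq_of_eq_add_mul_deriv isOpen_ball hq.analytic.differentiableOn (fun _ _ => rfl) hz]
  have hdiv : (2 * deriv q z + z * deriv (deriv q) z) / deriv q z =
      1 + (1 + z * deriv (deriv q) z / deriv q z) := by
    field_simp [hq.deriv_ne_zero z hz]
    ring
  rw [hdiv, Complex.add_re, Complex.one_re]
  linarith [hq.re_pos z hz]

theorem re_add_mul_deriv_sub_div_pos (hq : IsConvexFunction q) {w ζ : ℂ} (hw : w ∈ ball 0 1)
    (hζ : ζ ∈ ball 0 1) (hne : w ≠ ζ) :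
    0 < ((q ζ + ζ * deriv q ζ - (q w + w * deriv q w)) / (q ζ - q w)).re := by
  set h : ℂ → ℂ := fun z => q z + z * deriv q z
  set g : ℂ → ℂ := Function.invFunOn q (ball 0 1)
  have hgq : ∀ z ∈ ball (0 : ℂ) 1, g (q z) = z := hq.injOn.leftInvOn_invFunOn
  have hderiv : ∀ y ∈ q '' ball 0 1, HasDerivAt (h ∘ g) (deriv h (g y) / deriv q (g y)) y := by
    rintro _ ⟨z, hz, rfl⟩
    have hh : DifferentiableAt ℂ h z := (hq.analytic z hz).differentiableAt.add
      (differentiableAt_id.mul (hq.analytic.deriv z hz).differentiableAt)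
    have hg : HasDerivAt g (deriv q z)⁻¹ (q z) := hasDerivAt_invFunOn isOpen_ball
      hq.analytic.differentiableOn hq.injOn hz (hq.deriv_ne_zero z hz)
    rw [← hgq z hz] at hh
    simpa only [hgq z hz, div_eq_mul_inv] using hh.hasDerivAt.comp (q z) hg
  have hpos : ∀ y ∈ q '' ball 0 1, 0 < (deriv h (g y) / deriv q (g y)).re := by
    rintro _ ⟨z, hz, rfl⟩
    rw [hgq z hz]
    exact hq.re_deriv_add_mul_deriv_div_pos hz
  have hslope := re_sub_div_sub_pos_of_re_deriv_pos hq.convex_image hderiv hpos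
    (mem_image_of_mem q hw) (mem_image_of_mem q hζ) (hq.injOn.ne hw hζ hne)
  simpa only [Function.comp_apply, hgq w hw, hgq ζ hζ] using hslope

theorem norm_le_of_add_mul_deriv_eq_add_ray (hq : IsConvexFunction q) {w ζ : ℂ} {t : ℝ}
    (hw : w ∈ ball 0 1) (hζ : ζ ∈ ball 0 1) (ht : 0 ≤ t)
    (heq : q w + w * deriv q w = q ζ + ζ * deriv q ζ + t * (ζ * deriv q ζ)) : ‖ζ‖ ≤ ‖w‖ := by
  by_contra! hlt
  have hne : w ≠ ζ := fun h => hlt.ne (congrArg norm h)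
  have hconv := hq.re_sub_div_pos_of_norm_le hζ hlt.le hne
  have hslope := hq.re_add_mul_deriv_sub_div_pos hw hζ hne
  set B := (q ζ - q w) / (ζ * deriv q ζ) with hB
  have hslope_eq : (q ζ + ζ * deriv q ζ - (q w + w * deriv q w)) / (q ζ - q w) =
      ((-t : ℝ) : ℂ) * B⁻¹ := by
    rw [heq, hB, inv_div]
    push_cast
    ring
  rw [hslope_eq, Complex.re_ofReal_mul, Complex.inv_re] at hslope
  exact hslope.not_ge (mul_nonpos_of_nonpos_of_nonneg (neg_nonpos.2 ht)
    (div_nonneg hconv.le (Complex.normSq_nonneg B)))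

theorem norm_le_of_add_mul_deriv_eq (hq : IsConvexFunction q) {w ω : ℂ → ℂ} {R : ℝ}
    (hω : DifferentiableOn ℂ ω (ball 0 R)) (hω0 : ω 0 = 0)
    (hωmaps : MapsTo ω (ball 0 R) (ball 0 1)) (hwmaps : MapsTo w (ball 0 R) (ball 0 1))
    (hwle : ∀ z ∈ ball 0 R, ‖w z‖ ≤ ‖z‖)
    (heq : ∀ z ∈ ball 0 R,
      q (ω z) + z * deriv ω z * deriv q (ω z) = q (w z) + w z * deriv q (w z))
    {z : ℂ} (hz : z ∈ ball 0 R) : ‖ω z‖ ≤ ‖z‖ := by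
  have hsub : closedBall (0 : ℂ) ‖z‖ ⊆ ball 0 R := closedBall_subset_ball (mem_ball_zero_iff.1 hz)
  obtain ⟨z₀, hz₀, hmax⟩ := (isCompact_closedBall (0 : ℂ) ‖z‖).exists_isMaxOn
    ⟨z, by simp⟩ (hω.continuousOn.mono hsub).norm
  have hz₀R := hsub hz₀
  rw [mem_closedBall_zero_iff] at hz₀
  suffices hle : ‖ω z₀‖ ≤ ‖z₀‖ from (hmax (by simp)).trans (hle.trans hz₀)
  rcases eq_or_ne (ω z₀) 0 with hzero | hne
  · simp [hzero]
  obtain ⟨m, hm, hjack⟩ := jack_lemma hω hω0 (mem_ball_zero_iff.1 hz₀R) hne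
    fun x hx => hmax (mem_closedBall_zero_iff.2 (hx.trans hz₀))
  refine (hq.norm_le_of_add_mul_deriv_eq_add_ray (hwmaps hz₀R) (hωmaps hz₀R)
    (sub_nonneg.2 hm) ?_).trans (hwle z₀ hz₀R)
  rw [← heq z₀ hz₀R, hjack]
  push_cast
  ring

theorem hasDerivAt_invFunOn_comp (hq : IsConvexFunction q) {p : ℂ → ℂ} {z : ℂ}
    (hp : DifferentiableAt ℂ p z) (hpz : p z ∈ q '' ball 0 1) :
    HasDerivAt (fun z => Function.invFunOn q (ball 0 1) (p z))
      (deriv p z / deriv q (Function.invFunOn q (ball 0 1) (p z))) z := by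
  obtain ⟨ζ, hζ, hqζ⟩ := hpz
  have hg := hasDerivAt_invFunOn isOpen_ball hq.analytic.differentiableOn hq.injOn hζ
    (hq.deriv_ne_zero ζ hζ)
  rw [← hqζ, hq.injOn.leftInvOn_invFunOn hζ, div_eq_inv_mul]
  exact (hqζ ▸ hg).comp z hp.hasDerivAt

theorem norm_invFunOn_comp_le (hq : IsConvexFunction q) {p w : ℂ → ℂ} {R : ℝ}
    (hp : DifferentiableOn ℂ p (ball 0 R)) (hp0 : p 0 = q 0)
    (hwmaps : MapsTo w (ball 0 R) (ball 0 1)) (hwle : ∀ z ∈ ball 0 R, ‖w z‖ ≤ ‖z‖)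
    (heq : ∀ z ∈ ball 0 R, p z + z * deriv p z = q (w z) + w z * deriv q (w z))
    (hmaps : MapsTo p (ball 0 R) (q '' ball 0 1)) {z : ℂ} (hz : z ∈ ball 0 R) :
    ‖Function.invFunOn q (ball 0 1) (p z)‖ ≤ ‖z‖ := by
  set ω : ℂ → ℂ := fun z => Function.invFunOn q (ball 0 1) (p z)
  have hω : ∀ z ∈ ball 0 R, HasDerivAt ω (deriv p z / deriv q (ω z)) z := fun z hz =>
    hq.hasDerivAt_invFunOn_comp (hp.differentiableAt (isOpen_ball.mem_nhds hz)) (hmaps hz)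
  have hωmaps : MapsTo ω (ball 0 R) (ball 0 1) := fun z hz => Function.invFunOn_mem (hmaps hz)
  have hω0 : ω 0 = 0 := by
    simp only [ω, hp0, hq.injOn.leftInvOn_invFunOn (mem_ball_self one_pos)]
  refine hq.norm_le_of_add_mul_deriv_eq
    (fun z hz => (hω z hz).differentiableAt.differentiableWithinAt) hω0 hωmaps hwmaps hwle
    (fun z hz => ?_) hz
  rw [(hω z hz).deriv, mul_assoc, div_mul_cancel₀ _ (hq.deriv_ne_zero _ (hωmaps hz)),
    Function.invFunOn_eq (hmaps hz), heq z hz]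

theorem mapsTo_image_of_add_mul_deriv_eq (hq : IsConvexFunction q) {p w : ℂ → ℂ}
    (hp : AnalyticOnNhd ℂ p (ball 0 1)) (hp0 : p 0 = q 0)
    (hwle : ∀ z ∈ ball 0 1, ‖w z‖ ≤ ‖z‖)
    (heq : ∀ z ∈ ball 0 1, p z + z * deriv p z = q (w z) + w z * deriv q (w z)) :
    MapsTo p (ball 0 1) (q '' ball 0 1) := by
  have hopen : IsOpen (ball (0 : ℂ) 1 ∩ p ⁻¹' (q '' ball 0 1)) :=
    hp.continuousOn.isOpen_inter_preimage isOpen_ball hq.isOpen_image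
  have h0 : (0 : ℂ) ∈ ball (0 : ℂ) 1 ∩ p ⁻¹' (q '' ball 0 1) :=
    ⟨mem_ball_self one_pos, 0, mem_ball_self one_pos, hp0.symm⟩
  have hwmaps : MapsTo w (ball 0 1) (ball 0 1) := fun z hz =>
    mem_ball_zero_iff.2 ((hwle z hz).trans_lt (mem_ball_zero_iff.1 hz))
  refine fun z hz => (ball_subset_of_forall_sphere_subset hopen h0 (fun r hr hr1 hsub => ?_) hz).2
  have hball : ball (0 : ℂ) r ⊆ ball 0 1 := ball_subset_ball hr1.le
  have hclosedBall : closedBall (0 : ℂ) r ⊆ ball 0 1 := closedBall_subset_ball hr1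
  have hclosed : IsClosed (q '' closedBall 0 r) := ((isCompact_closedBall _ _).image_of_continuousOn
    (hq.analytic.continuousOn.mono hclosedBall)).isClosed
  have hmaps : MapsTo p (ball 0 r) (q '' closedBall 0 r) := fun z hz => by
    have hle := hq.norm_invFunOn_comp_le (hp.differentiableOn.mono hball) hp0
      (hwmaps.mono_left hball)
      (fun z hz => hwle z (hball hz)) (fun z hz => heq z (hball hz))
      (fun z hz => (hsub hz).2) hz
    exact ⟨_, mem_closedBall_zero_iff.2 (hle.trans (mem_ball_zero_iff.1 hz).le),
      Function.invFunOn_eq (hsub hz).2⟩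
  have hclosure := hmaps.closure_of_continuousOn
    (hp.continuousOn.mono ((closure_ball (0 : ℂ) hr.ne').trans_subset hclosedBall))
  rw [closure_ball (0 : ℂ) hr.ne', hclosed.closure_eq] at hclosure
  exact fun z hz => ⟨hclosedBall (sphere_subset_closedBall hz),
    image_mono hclosedBall (hclosure (sphere_subset_closedBall hz))⟩

end IsConvexFunction

theorem IsSchwarzFunction.norm_le {w : ℂ → ℂ} (hw : IsSchwarzFunction w) {z : ℂ}
    (hz : z ∈ ball 0 1) : ‖w z‖ ≤ ‖z‖ :=
  Complex.norm_le_norm_of_mapsTo_ball hw.1.differentiableOn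
    (hw.2.1.mono_right ball_subset_closedBall) hw.2.2 (mem_ball_zero_iff.1 hz)

theorem IsSchwarzFunction.comp {v w : ℂ → ℂ} (hv : IsSchwarzFunction v)
    (hw : IsSchwarzFunction w) : IsSchwarzFunction (v ∘ w) :=
  ⟨hv.1.comp hw.1 hw.2.1, hv.2.1.comp hw.2.1, (congrArg v hw.2.2).trans hv.2.2⟩

theorem Subordinate.trans {F G H : ℂ → ℂ} : Subordinate F G → Subordinate G H → Subordinate F H
  | ⟨w, hw, hF⟩, ⟨v, hv, hG⟩ =>
    ⟨v ∘ w, hv.comp hw, fun z hz => (hF z hz).trans (hG (w z) (hw.2.1 hz))⟩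

theorem Subordinate.map_zero {F G : ℂ → ℂ} : Subordinate F G → F 0 = G 0
  | ⟨_, hw, hF⟩ => (hF 0 (mem_ball_self one_pos)).trans (congrArg G hw.2.2)

theorem Subordinate.congr_left {F F' G : ℂ → ℂ} (hF : EqOn F F' (ball 0 1)) :
    Subordinate F' G → Subordinate F G
  | ⟨w, hw, hF'⟩ => ⟨w, hw, fun z hz => (hF hz).trans (hF' z hz)⟩

theorem Subordinate.congr_right {F G G' : ℂ → ℂ} (hG : EqOn G G' (ball 0 1)) :
    Subordinate F G → Subordinate F G'
  | ⟨w, hw, hF⟩ => ⟨w, hw, fun z hz => (hF z hz).trans (hG (hw.2.1 hz))⟩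

theorem IsConvexFunction.subordinate_of_add_mul_deriv {p q : ℂ → ℂ} (hq : IsConvexFunction q)
    (hp : AnalyticOnNhd ℂ p (ball 0 1))
    (hpq : Subordinate (fun z => p z + z * deriv p z) (fun z => q z + z * deriv q z)) :
    Subordinate p q := by
  have hp0 : p 0 = q 0 := by simpa using hpq.map_zero
  obtain ⟨w, hw, heq⟩ := hpq
  have hmaps : MapsTo p (ball 0 1) (q '' ball 0 1) :=
    hq.mapsTo_image_of_add_mul_deriv_eq hp hp0 (fun z => hw.norm_le) heq
  have hω : DifferentiableOn ℂ (fun z => Function.invFunOn q (ball 0 1) (p z)) (ball 0 1) :=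
    fun z hz => (hq.hasDerivAt_invFunOn_comp (hp z hz).differentiableAt
      (hmaps hz)).differentiableAt.differentiableWithinAt
  refine ⟨_, ⟨hω.analyticOnNhd isOpen_ball, fun z hz => Function.invFunOn_mem (hmaps hz), ?_⟩,
    fun z hz => (Function.invFunOn_eq (hmaps hz)).symm⟩
  simp only [hp0, hq.injOn.leftInvOn_invFunOn (mem_ball_self one_pos)]

/-! ### Starlikeness -/

theorem QuotientSubordinate.subordinate_of_eq_mul {N M Q G : ℂ → ℂ}
    (hNM : QuotientSubordinate N M G) (hQ : AnalyticOnNhd ℂ Q (ball 0 1))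
    (hN : ∀ z ∈ ball 0 1, N z = M z * Q z) (hM : ∃ᶠ z in 𝓝[≠] 0, M z ≠ 0) : Subordinate Q G := by
  obtain ⟨F, hF, hFN, hFG⟩ := hNM
  refine hFG.congr_left (hQ.eqOn_of_preconnected_of_frequently_eq hF
    (convex_ball 0 1).isPreconnected (mem_ball_self one_pos) ?_)
  have hball : ∀ᶠ z in 𝓝[≠] (0 : ℂ), z ∈ ball (0 : ℂ) 1 :=
    mem_nhdsWithin_of_mem_nhds (ball_mem_nhds 0 one_pos)
  refine (hM.and_eventually hball).mono fun z ⟨hMz, hz⟩ => ?_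
  rw [hFN z hz hMz, hN z hz, mul_div_cancel_left₀ _ hMz]

theorem eq_mul_deriv_mul_one_sub_radialAverage {f F : ℂ → ℂ} (hf : AnalyticOnNhd ℂ f (ball 0 1))
    (hf0 : f 0 = 0) (hf1 : deriv f 0 ≠ 0) (hF : AnalyticOnNhd ℂ F (ball 0 1))
    (hfF : ∀ z ∈ ball 0 1, deriv f z ^ 2 ≠ 0 → F z = f z * deriv (deriv f) z / deriv f z ^ 2) :
    EqOn f (fun z => z * deriv f z * (1 - radialAverage F z)) (ball 0 1) := by
  have h0 : (0 : ℂ) ∈ ball (0 : ℂ) 1 := mem_ball_self one_pos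
  have hA : AnalyticOnNhd ℂ (radialAverage F) (ball 0 1) :=
    (differentiableOn_radialAverage hF.differentiableOn).analyticOnNhd isOpen_ball
  have hne : ∀ᶠ z in 𝓝 (0 : ℂ), z ∈ ball (0 : ℂ) 1 ∧ deriv f z ≠ 0 :=
    (isOpen_ball.eventually_mem h0).and ((hf.deriv 0 h0).continuousAt.eventually_ne hf1)
  obtain ⟨ε, hε, hεne⟩ := Metric.eventually_nhds_iff_ball.1 hne
  have hprim : ∀ z ∈ ball 0 ε, HasDerivAt (fun z => z - f z / deriv f z) (F z) z := fun z hz => by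
    obtain ⟨hz1, hz2⟩ := hεne z hz
    convert! (hasDerivAt_id' z).fun_sub ((hf z hz1).differentiableAt.hasDerivAt.fun_div
      (hf.deriv z hz1).differentiableAt.hasDerivAt hz2) using 1
    rw [hfF z hz1 (pow_ne_zero 2 hz2)]
    field_simp
    ring
  refine hf.eqOn_of_preconnected_of_eventuallyEq
    ((analyticOnNhd_id.mul hf.deriv).mul (analyticOnNhd_const.sub hA))
    (convex_ball 0 1).isPreconnected h0 ?_
  filter_upwards [ball_mem_nhds (0 : ℂ) hε] with z hz
  have havg := mul_radialAverage_eq_sub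
    (hF.continuousOn.mono fun z hz => (hεne z hz).1) hprim hz
  have hz2 := (hεne z hz).2
  simp only [hf0, zero_div, sub_zero] at havg
  calc f z = deriv f z * (z - (z - f z / deriv f z)) := by field_simp; ring
    _ = z * deriv f z * (1 - radialAverage F z) := by rw [← havg]; ring

theorem mem_starlikeClass_of_subordinate {f ψ p : ℂ → ℂ} (hf : IsNormalizedAnalytic f)
    (hψ : AnalyticOnNhd ℂ ψ (ball 0 1)) (hψ0 : ∀ z ∈ ball 0 1, ψ z ≠ 0)
    (hp : Subordinate p fun z => (ψ z - 1) / ψ z)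
    (hfp : EqOn f (fun z => z * deriv f z * (1 - p z)) (ball 0 1)) : f ∈ starlikeClass ψ := by
  obtain ⟨w, hw, hpw⟩ := hp
  refine ⟨hf, ψ ∘ w, hψ.comp hw.1 hw.2.1, fun z hz hfz => ?_, w, hw, fun z _ => rfl⟩
  have hψw : ψ (w z) ≠ 0 := hψ0 _ (hw.2.1 hz)
  have hinv : 1 - p z = (ψ (w z))⁻¹ := by
    rw [hpw z hz]
    field_simp
    ring
  have hfz_eq : f z = z * deriv f z * (ψ (w z))⁻¹ := hinv ▸ hfp hz
  rw [eq_div_iff hfz, hfz_eq, Function.comp_apply]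
  field_simp

theorem mainTheorem9_general (ψ h : ℂ → ℂ) (hψ : AnalyticOnNhd ℂ ψ (ball 0 1))
    (hψ0 : ∀ z ∈ ball 0 1, ψ z ≠ 0) (hh : AnalyticOnNhd ℂ h (ball 0 1)) (hh1 : deriv h 0 ≠ 0)
    (hre : ∀ z ∈ ball (0 : ℂ) 1,
      -(1 / 2 : ℝ) < (1 + z * deriv (deriv h) z / deriv h z).re)
    (hint : QuotientSubordinate (integralFromZero h) (fun z => z)
      (fun z => (ψ z - 1) / ψ z))
    (f : ℂ → ℂ) (hf : IsNormalizedAnalytic f)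
    (hsub : QuotientSubordinate (fun z => f z * deriv (deriv f) z)
      (fun z => (deriv f z) ^ 2) h) :
    f ∈ starlikeClass ψ := by
  obtain ⟨F, hF, hfF, hFh⟩ := hsub
  have hp : AnalyticOnNhd ℂ (radialAverage F) (ball 0 1) :=
    (differentiableOn_radialAverage hF.differentiableOn).analyticOnNhd isOpen_ball
  have hq : IsConvexFunction (radialAverage h) := isConvexFunction_radialAverage hh hh1 hre
  have hpq : Subordinate (radialAverage F) (radialAverage h) :=
    hq.subordinate_of_add_mul_deriv hp <|
      (hFh.congr_left fun _ => radialAverage_add_mul_deriv hF.differentiableOn).congr_right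
        fun _ hz => (radialAverage_add_mul_deriv hh.differentiableOn hz).symm
  have hqψ : Subordinate (radialAverage h) fun z => (ψ z - 1) / ψ z :=
    hint.subordinate_of_eq_mul hq.analytic
      (fun z _ => integralFromZero_eq_mul_radialAverage h z)
      (eventually_mem_nhdsWithin (s := {(0 : ℂ)}ᶜ)).frequently
  have hf_eq : EqOn f (fun z => z * deriv f z * (1 - radialAverage F z)) (ball 0 1) :=
    eq_mul_deriv_mul_one_sub_radialAverage hf.1 hf.2.1 (hf.2.2 ▸ one_ne_zero) hF hfF
  exact mem_starlikeClass_of_subordinate hf hψ hψ0 (hpq.trans hqψ) hf_eq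

theorem mainTheorem9 (ψ h : ℂ → ℂ) (hψ : IsMaMinda ψ)
    (hh : AnalyticOnNhd ℂ h (ball 0 1)) (hh0 : h 0 = 0) (hh1 : deriv h 0 ≠ 0)
    (hre : ∀ z ∈ ball (0 : ℂ) 1,
      -(1 / 2 : ℝ) < (1 + z * deriv (deriv h) z / deriv h z).re)
    (hint : QuotientSubordinate (integralFromZero h) (fun z => z)
      (fun z => (ψ z - 1) / ψ z))
    (f : ℂ → ℂ) (hf : IsNormalizedAnalytic f)
    (hsub : QuotientSubordinate (fun z => f z * deriv (deriv f) z)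
      (fun z => (deriv f z) ^ 2) h) :
    f ∈ starlikeClass ψ :=
  mainTheorem9_general ψ h hψ.analytic
    (fun z hz hzero => (hψ.re_pos z hz).ne' (congrArg Complex.re hzero)) hh hh1 hre hint f hf hsub
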